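/- For every integer $m>1$, $$\ln\frac{4}{\pi}=(m-2)!\int_{[0,1]^m}\frac{m-1-x_1-x_1x_2-\cdots-x_1x_2\cdots x_{m-1}}{(1+x_1x_2\cdots x_m)\,(-\ln (x_1x_2\cdots x_m))^{m-1}}\,dx_1\,dx_2\cdots dx_m,$$ where the integrand is Lebesgue integrable over $[0,1]^m$. -/

import Mathlib

open MeasureTheory Filter Topology

/-! Write P for the product of all coordinates, m = j + 2, and expand 1 / (1 + P) as the alternating
geometric series in P. In the n-th term, P ^ n / (-log P) ^ (j + 1) is 1 / j! times the integral of
t ^ j * P ^ (t + n) over t > 0. Everything is nonnegative, so the t- and x-integrals may be swapped;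
the cube integral is then a product of one-variable power integrals and yields a rational function
of t with an explicit antiderivative. Whatever j is, the result is 1 / (n + 1) - log ((n + 2) / (n +
1)) (`factorial_mul_integral_cubeTerm`). The alternating sum of these values is log 2 - log (π / 2),
by the alternating harmonic series and Wallis' product (`hasSum_alternating_log_four_div_pi`). -/

/-! ### The alternating series for log (4 / π) -/

theorem log_succ_sub_log_bounds (n : ℕ) :
    0 ≤ 1 / ((n : ℝ) + 1) - (Real.log (n + 2) - Real.log (n + 1)) ∧
    1 / ((n : ℝ) + 1) - (Real.log (n + 2) - Real.log (n + 1)) ≤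
      1 / ((n : ℝ) + 1) - 1 / ((n + 1 : ℕ) + 1) := by
  have h1 : (0 : ℝ) < n + 1 := by positivity
  have h2 : (0 : ℝ) < n + 2 := by positivity
  have hlog := Real.log_div h2.ne' h1.ne'
  have hu := Real.log_le_sub_one_of_pos (div_pos h2 h1)
  have hl := Real.one_sub_inv_le_log_of_pos (div_pos h2 h1)
  have e1 : ((n : ℝ) + 2) / (n + 1) - 1 = 1 / (n + 1) := by field_simp; ring
  have e2 : 1 - (((n : ℝ) + 2) / (n + 1))⁻¹ = 1 / ((n + 1 : ℕ) + 1) := by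
    push_cast; field_simp; ring
  rw [hlog, e1] at hu
  rw [hlog, e2] at hl
  constructor <;> linarith

theorem summable_one_div_sub_log :
    Summable fun n : ℕ => 1 / ((n : ℝ) + 1) - (Real.log (n + 2) - Real.log (n + 1)) := by
  refine summable_of_sum_range_le (c := 1) (fun n => (log_succ_sub_log_bounds n).1) fun k => ?_
  refine (Finset.sum_le_sum fun n _ => (log_succ_sub_log_bounds n).2).trans ?_
  rw [Finset.sum_range_sub' (fun n : ℕ => 1 / ((n : ℝ) + 1)) k]
  have : (0 : ℝ) ≤ 1 / ((k : ℝ) + 1) := by positivity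
  simp only [Nat.cast_zero]
  linarith

/-- The partial sums are H_{2k} - H_k; Euler's constant cancels and log (2k) - log k remains. -/
theorem tendsto_alternating_harmonic :
    Tendsto (fun k : ℕ => ∑ i ∈ Finset.range k, (1 / (2 * (i : ℝ) + 1) - 1 / (2 * i + 2)))
      atTop (𝓝 (Real.log 2)) := by
  have key : ∀ k : ℕ, ∑ i ∈ Finset.range k, (1 / (2 * (i : ℝ) + 1) - 1 / (2 * i + 2)) =
      (harmonic (2 * k) : ℝ) - harmonic k := by
    intro k
    induction k with
    | zero => simp
    | succ k ih =>
      rw [Finset.sum_range_succ, ih, show 2 * (k + 1) = 2 * k + 1 + 1 by ring, harmonic_succ,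
        harmonic_succ, harmonic_succ]
      push_cast
      field_simp
      ring
  have h2 : Tendsto (fun k : ℕ => 2 * k) atTop atTop :=
    tendsto_id.const_mul_atTop' (by norm_num)
  have h := ((Real.tendsto_harmonic_sub_log.comp h2).sub Real.tendsto_harmonic_sub_log).add_const
    (Real.log 2)
  rw [sub_self, zero_add] at h
  refine h.congr' ?_
  filter_upwards [eventually_gt_atTop 0] with k hk
  have hk' : (k : ℝ) ≠ 0 := by positivity
  rw [key]
  simp only [Function.comp_apply]
  push_cast
  rw [Real.log_mul two_ne_zero hk']
  ring

theorem tendsto_log_wallis :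
    Tendsto (fun k : ℕ => ∑ i ∈ Finset.range k,
      ((Real.log (2 * i + 2) - Real.log (2 * i + 1)) -
        (Real.log (2 * i + 3) - Real.log (2 * i + 2)))) atTop (𝓝 (Real.log (Real.pi / 2))) := by
  have h := ((Real.continuousAt_log (by positivity : Real.pi / 2 ≠ 0)).tendsto).comp
    Real.tendsto_prod_pi_div_two
  refine h.congr fun k => ?_
  rw [Function.comp_apply, Real.log_prod fun i _ => by positivity]
  refine Finset.sum_congr rfl fun i _ => ?_
  have h1 : 2 * (i : ℝ) + 1 ≠ 0 := by positivity
  have h2 : 2 * (i : ℝ) + 2 ≠ 0 := by positivity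
  have h3 : 2 * (i : ℝ) + 3 ≠ 0 := by positivity
  rw [Real.log_mul (div_ne_zero h2 h1) (div_ne_zero h2 h3), Real.log_div h2 h1, Real.log_div h2 h3]
  ring

theorem hasSum_alternating_log_four_div_pi :
    HasSum (fun n : ℕ => (-1 : ℝ) ^ n *
      (1 / ((n : ℝ) + 1) - (Real.log (n + 2) - Real.log (n + 1)))) (Real.log (4 / Real.pi)) := by
  have hs : Summable (fun n : ℕ => (-1 : ℝ) ^ n *
      (1 / ((n : ℝ) + 1) - (Real.log (n + 2) - Real.log (n + 1)))) := by
    refine Summable.of_norm (summable_one_div_sub_log.congr fun n => ?_)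
    rw [norm_mul, norm_pow, norm_neg, norm_one, one_pow, one_mul,
      Real.norm_of_nonneg (log_succ_sub_log_bounds n).1]
  -- Convergence being known, the limit can be read along even partial sums, which pair consecutive
  -- terms.
  have h2 : Tendsto (fun k : ℕ => 2 * k) atTop atTop :=
    tendsto_id.const_mul_atTop' (by norm_num)
  have ht := hs.hasSum.tendsto_sum_nat.comp h2
  have ht' := tendsto_alternating_harmonic.sub tendsto_log_wallis
  have e : Real.log 2 - Real.log (Real.pi / 2) = Real.log (4 / Real.pi) := by
    rw [← Real.log_div two_ne_zero (by positivity)]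
    congr 1
    field_simp
    norm_num
  rw [e] at ht'
  have := tendsto_nhds_unique ht (ht'.congr fun k => ?_)
  · rw [← this]; exact hs.hasSum
  · rw [Function.comp_apply, ← Finset.sum_sub_distrib]
    induction k with
    | zero => simp
    | succ k ih =>
      rw [Finset.sum_range_succ, ih, show 2 * (k + 1) = 2 * k + 1 + 1 by ring,
        Finset.sum_range_succ, Finset.sum_range_succ, pow_succ, pow_mul]
      push_cast
      rw [show (2 * (k : ℝ) + 1 + 1) = 2 * k + 2 by ring,
        show (2 * (k : ℝ) + 1 + 2) = 2 * k + 3 by ring]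
      norm_num
      ring

/-! ### The integral of the rational function over the half-line -/

/-- An antiderivative of `t ^ j / (t + N) ^ (j + 1)`. -/
noncomputable def logSubSum (j : ℕ) (N t : ℝ) : ℝ :=
  Real.log (t + N) - ∑ i ∈ Finset.range j, (t / (t + N)) ^ (i + 1) / (i + 1)

theorem hasDerivAt_div_add_pow (i : ℕ) {N t : ℝ} (h : t + N ≠ 0) :
    HasDerivAt (fun t => (t / (t + N)) ^ (i + 1)) ((i + 1) * N * t ^ i / (t + N) ^ (i + 2)) t := by
  have h1 : HasDerivAt (fun t => t / (t + N)) (N / (t + N) ^ 2) t := by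
    refine ((hasDerivAt_id t).div ((hasDerivAt_id t).add_const N) h).congr_deriv ?_
    simp
  refine (h1.pow (i + 1)).congr_deriv ?_
  rw [div_pow]
  push_cast
  field_simp
  ring

theorem hasDerivAt_logSubSum (j : ℕ) {N t : ℝ} (h : t + N ≠ 0) :
    HasDerivAt (logSubSum j N) (t ^ j / (t + N) ^ (j + 1)) t := by
  unfold logSubSum
  induction j with
  | zero =>
    simpa using ((hasDerivAt_id t).add_const N).log h
  | succ j ih =>
    have h2 := ih.sub ((hasDerivAt_div_add_pow j h).div_const ((j : ℝ) + 1))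
    simp only [Finset.sum_range_succ]
    refine (h2.congr_deriv ?_).congr_of_eventuallyEq (Eventually.of_forall fun s => ?_)
    · have : (j : ℝ) + 1 ≠ 0 := by positivity
      field_simp
      ring
    · simp only [Pi.sub_apply]
      ring

theorem tendsto_div_add_atTop (N : ℝ) : Tendsto (fun t : ℝ => t / (t + N)) atTop (𝓝 1) := by
  have h : Tendsto (fun t : ℝ => 1 - N / (t + N)) atTop (𝓝 (1 - 0)) :=
    tendsto_const_nhds.sub ((tendsto_atTop_add_const_right _ N tendsto_id).const_div_atTop N)
  rw [sub_zero] at h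
  refine h.congr' ?_
  filter_upwards [eventually_gt_atTop (-N)] with t ht
  have : t + N ≠ 0 := by linarith
  field_simp
  ring

/-- Each logarithm diverges, but t / (t + N) tends to 1 for every N, so the finite sums cancel in
the limit, as do the logarithms. -/
theorem tendsto_logSubSum_succ_sub (j : ℕ) (N : ℝ) :
    Tendsto (fun t => logSubSum j (N + 1) t - logSubSum j N t) atTop (𝓝 0) := by
  have hs : ∀ M : ℝ, Tendsto
      (fun t => ∑ i ∈ Finset.range j, (t / (t + M)) ^ (i + 1) / ((i : ℝ) + 1)) atTop
      (𝓝 (∑ i ∈ Finset.range j, (1 : ℝ) ^ (i + 1) / ((i : ℝ) + 1))) := fun M =>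
    tendsto_finsetSum _ fun i _ => ((tendsto_div_add_atTop M).pow _).div_const _
  have hl : Tendsto (fun t => Real.log (t / (t + N)) - Real.log (t / (t + (N + 1)))) atTop
      (𝓝 0) := by
    have := ((Real.continuousAt_log one_ne_zero).tendsto.comp (tendsto_div_add_atTop N)).sub
      ((Real.continuousAt_log one_ne_zero).tendsto.comp (tendsto_div_add_atTop (N + 1)))
    simpa using this
  have := (hl.sub (hs (N + 1))).add (hs N)
  simp only [zero_sub, neg_add_cancel] at this
  refine this.congr' ?_
  filter_upwards [eventually_gt_atTop (-N), eventually_gt_atTop 0] with t h1 h2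
  rw [Real.log_div h2.ne' (by linarith), Real.log_div h2.ne' (by linarith), logSubSum, logSubSum]
  ring

/-- For a nonnegative derivative, a finite limit of the antiderivative already gives integrability.
The limit at infinity contributes 1 / N, the value at 0 the logarithms. -/
theorem integrableOn_and_integral_Ioi_rational (j : ℕ) {N : ℝ} (hN : 0 < N)
    (hnonneg : ∀ t ∈ Set.Ioi (0 : ℝ), 0 ≤ t ^ j * ((j + 1) / (t + N) ^ (j + 2) -
      1 / (t + N) ^ (j + 1) + 1 / (t + N + 1) ^ (j + 1))) :
    IntegrableOn (fun t : ℝ => t ^ j * ((j + 1) / (t + N) ^ (j + 2) - 1 / (t + N) ^ (j + 1) +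
      1 / (t + N + 1) ^ (j + 1))) (Set.Ioi 0) ∧
    ∫ t in Set.Ioi (0 : ℝ), t ^ j * ((j + 1) / (t + N) ^ (j + 2) - 1 / (t + N) ^ (j + 1) +
      1 / (t + N + 1) ^ (j + 1)) = 1 / N - (Real.log (N + 1) - Real.log N) := by
  have hd : ∀ t ∈ Set.Ici (0 : ℝ), HasDerivAt
      (fun t => (t / (t + N)) ^ (j + 1) / N + (logSubSum j (N + 1) t - logSubSum j N t))
      (t ^ j * ((j + 1) / (t + N) ^ (j + 2) - 1 / (t + N) ^ (j + 1) +
        1 / (t + N + 1) ^ (j + 1))) t := by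
    intro t ht
    have ht : 0 ≤ t := ht
    have h1 : t + N ≠ 0 := by positivity
    have h2 : t + (N + 1) ≠ 0 := by positivity
    refine (((hasDerivAt_div_add_pow j h1).div_const N).add
      ((hasDerivAt_logSubSum j h2).sub (hasDerivAt_logSubSum j h1))).congr_deriv ?_
    rw [add_assoc t N 1]
    field_simp
    ring
  have hl : Tendsto
      (fun t => (t / (t + N)) ^ (j + 1) / N + (logSubSum j (N + 1) t - logSubSum j N t)) atTop
      (𝓝 (1 / N)) := by
    have := (((tendsto_div_add_atTop N).pow (j + 1)).div_const N).add
      (tendsto_logSubSum_succ_sub j N)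
    simpa using this
  refine ⟨integrableOn_Ioi_deriv_of_nonneg' hd hnonneg hl, ?_⟩
  rw [integral_Ioi_of_hasDerivAt_of_nonneg' hd hnonneg hl]
  simp [logSubSum]

/-! ### Monomial integrals over the cube -/

/-- Lebesgue measure on the open unit cube, as a product measure. -/
noncomputable def cubeMeasure (m : ℕ) : Measure (Fin m → ℝ) :=
  Measure.pi fun _ => volume.restrict (Set.Ioo (0 : ℝ) 1)

instance (m : ℕ) : IsProbabilityMeasure (cubeMeasure m) := by
  have : IsProbabilityMeasure (volume.restrict (Set.Ioo (0 : ℝ) 1)) := ⟨by simp⟩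
  unfold cubeMeasure
  infer_instance

theorem cubeMeasure_eq_restrict_Icc (m : ℕ) :
    cubeMeasure m = volume.restrict (Set.Icc (0 : Fin m → ℝ) 1) := by
  have h : volume.restrict (Set.Ioo (0 : ℝ) 1) = volume.restrict (Set.Icc (0 : ℝ) 1) :=
    Measure.restrict_congr_set Ioo_ae_eq_Icc
  rw [cubeMeasure, h, ← Set.pi_univ_Icc, volume_pi, Measure.restrict_pi_pi]
  rfl

theorem ae_cubeMeasure_mem_Ioo (m : ℕ) :
    ∀ᵐ x ∂cubeMeasure m, ∀ i, x i ∈ Set.Ioo (0 : ℝ) 1 := by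
  have : ∀ᵐ x ∂cubeMeasure m, x ∈ Set.univ.pi fun _ => Set.Ioo (0 : ℝ) 1 := by
    rw [cubeMeasure, ← Measure.restrict_pi_pi]
    exact ae_restrict_mem (MeasurableSet.univ_pi fun _ => measurableSet_Ioo)
  filter_upwards [this] with x hx i using hx i trivial

theorem integrableOn_Ioo_rpow {s : ℝ} (hs : 0 < s) :
    IntegrableOn (fun x : ℝ => x ^ s) (Set.Ioo 0 1) :=
  (intervalIntegral.intervalIntegrable_rpow' (by linarith)).1.mono_set Set.Ioo_subset_Ioc_self

theorem integral_Ioo_rpow {s : ℝ} (hs : 0 < s) :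
    ∫ x in Set.Ioo (0 : ℝ) 1, x ^ s = 1 / (s + 1) := by
  rw [← integral_Ioc_eq_integral_Ioo, ← intervalIntegral.integral_of_le zero_le_one,
    integral_rpow (Or.inl (by linarith))]
  simp [Real.zero_rpow (by linarith : s + 1 ≠ 0)]

theorem integrable_prod_rpow {m : ℕ} {s : Fin m → ℝ} (hs : ∀ i, 0 < s i) :
    Integrable (fun x : Fin m → ℝ => ∏ i, x i ^ s i) (cubeMeasure m) :=
  Integrable.fintype_prod (f := fun i (y : ℝ) => y ^ s i) fun i => integrableOn_Ioo_rpow (hs i)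

theorem integral_prod_rpow {m : ℕ} {s : Fin m → ℝ} (hs : ∀ i, 0 < s i) :
    ∫ x, ∏ i, x i ^ s i ∂cubeMeasure m = ∏ i, 1 / (s i + 1) := by
  rw [cubeMeasure, integral_fintype_prod_eq_prod (fun i (y : ℝ) => y ^ s i)]
  exact Finset.prod_congr rfl fun i _ => integral_Ioo_rpow (hs i)

theorem prod_filter_mul_prod_rpow {m : ℕ} (k : ℕ) (s : ℝ) {x : Fin m → ℝ} (hx : ∀ i, 0 < x i) :
    (∏ i with Fin.val i < k, x i) * ∏ i, x i ^ s =
      ∏ i, x i ^ (if Fin.val i < k then s + 1 else s) := by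
  rw [Finset.prod_filter, ← Finset.prod_mul_distrib]
  refine Finset.prod_congr rfl fun i _ => ?_
  split_ifs
  · rw [Real.rpow_add_one (hx i).ne', mul_comm]
  · rw [one_mul]

theorem integrable_prod_filter_mul_prod_rpow (m k : ℕ) {s : ℝ} (hs : 0 < s) :
    Integrable (fun x : Fin m → ℝ => (∏ i with Fin.val i < k, x i) * ∏ i, x i ^ s)
      (cubeMeasure m) := by
  refine (integrable_prod_rpow (s := fun i : Fin m => if Fin.val i < k then s + 1 else s)
    fun i => by split_ifs <;> positivity).congr ?_
  filter_upwards [ae_cubeMeasure_mem_Ioo m] with x hx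
  exact (prod_filter_mul_prod_rpow k s fun i => (hx i).1).symm

theorem integral_prod_filter_mul_prod_rpow {m k : ℕ} (hk : k ≤ m) {s : ℝ} (hs : 0 < s) :
    ∫ x : Fin m → ℝ, (∏ i with Fin.val i < k, x i) * ∏ i, x i ^ s ∂cubeMeasure m =
      (1 / (s + 2)) ^ k * (1 / (s + 1)) ^ (m - k) := by
  have h : ∫ x : Fin m → ℝ, (∏ i with Fin.val i < k, x i) * ∏ i, x i ^ s ∂cubeMeasure m =
      ∫ x : Fin m → ℝ, ∏ i, x i ^ (if Fin.val i < k then s + 1 else s) ∂cubeMeasure m := by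
    refine integral_congr_ae ?_
    filter_upwards [ae_cubeMeasure_mem_Ioo m] with x hx
    exact prod_filter_mul_prod_rpow k s fun i => (hx i).1
  rw [h, integral_prod_rpow (s := fun i : Fin m => if Fin.val i < k then s + 1 else s)
    fun i => by split_ifs <;> positivity]
  have e : ∀ i : Fin m, 1 / ((if Fin.val i < k then s + 1 else s) + 1) =
      if Fin.val i < k then 1 / (s + 2) else 1 / (s + 1) := by
    intro i
    split_ifs
    · congr 1; ring
    · rfl
  have hc : (Finset.univ.filter fun i : Fin m => Fin.val i < k).card = k := by
    rw [Fin.card_filter_val_lt, min_eq_right hk]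
  have hc' : (Finset.univ.filter fun i : Fin m => ¬ Fin.val i < k).card = m - k := by
    have := Finset.card_filter_add_card_filter_not (s := Finset.univ)
      (fun i : Fin m => Fin.val i < k)
    rw [hc, Finset.card_univ, Fintype.card_fin] at this
    omega
  rw [Finset.prod_congr rfl fun i _ => e i, Finset.prod_ite, Finset.prod_const,
    Finset.prod_const, hc, hc']

/-- The numerator `∑ₖ (1 - x₁ ⋯ xₖ)`, the sum being over `1 ≤ k ≤ j + 1`. -/
noncomputable def cubeNumerator (j : ℕ) (x : Fin (j + 2) → ℝ) : ℝ :=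
  ∑ k ∈ Finset.Icc 1 (j + 1), (1 - ∏ i with Fin.val i < k, x i)

theorem cubeNumerator_nonneg {j : ℕ} {x : Fin (j + 2) → ℝ} (hx : ∀ i, x i ∈ Set.Ioo (0 : ℝ) 1) :
    0 ≤ cubeNumerator j x :=
  Finset.sum_nonneg fun _ _ => sub_nonneg.2 <|
    Finset.prod_le_one (fun i _ => (hx i).1.le) fun i _ => (hx i).2.le

/-- The mixed products telescope because 1 / a - 1 / (a + 1) = (1 / a) * (1 / (a + 1)). -/
theorem sum_geometric_mixed (j : ℕ) {a : ℝ} (ha : 0 < a) :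
    ∑ k ∈ Finset.Icc 1 (j + 1), ((1 / a) ^ (j + 2) - (1 / (a + 1)) ^ k * (1 / a) ^ (j + 2 - k)) =
      (j + 1) / a ^ (j + 2) - 1 / a ^ (j + 1) + 1 / (a + 1) ^ (j + 1) := by
  have key : ∑ k ∈ Finset.Icc 1 (j + 1), (1 / (a + 1)) ^ k * (1 / a) ^ (j + 2 - k) =
      1 / a ^ (j + 1) - 1 / (a + 1) ^ (j + 1) := by
    induction j with
    | zero => simp; field_simp; ring
    | succ j ih =>
      rw [Finset.sum_Icc_succ_top (by omega)]
      have : ∑ k ∈ Finset.Icc 1 (j + 1), (1 / (a + 1)) ^ k * (1 / a) ^ (j + 1 + 2 - k) =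
          (∑ k ∈ Finset.Icc 1 (j + 1), (1 / (a + 1)) ^ k * (1 / a) ^ (j + 2 - k)) * (1 / a) := by
        rw [Finset.sum_mul]
        refine Finset.sum_congr rfl fun k hk => ?_
        have := (Finset.mem_Icc.1 hk).2
        rw [show j + 1 + 2 - k = j + 2 - k + 1 by omega, pow_succ]
        ring
      rw [this, ih, show j + 1 + 2 - (j + 1 + 1) = 1 by omega, one_div_pow]
      field_simp
      ring
  rw [Finset.sum_sub_distrib, key, Finset.sum_const, Nat.card_Icc]
  simp
  ring

/-- Writing 1 as the empty product `k = 0` lets one monomial formula serve both parts of each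
summand. -/
theorem cubeNumerator_mul (j : ℕ) (x : Fin (j + 2) → ℝ) (c : ℝ) :
    cubeNumerator j x * c = ∑ k ∈ Finset.Icc 1 (j + 1),
      ((∏ i with Fin.val i < 0, x i) * c - (∏ i with Fin.val i < k, x i) * c) := by
  simp [cubeNumerator, Finset.sum_mul, sub_mul]

theorem integrable_cubeNumerator_mul_prod_rpow (j : ℕ) {s : ℝ} (hs : 0 < s) :
    Integrable (fun x => cubeNumerator j x * ∏ i, x i ^ s) (cubeMeasure (j + 2)) := by
  simp only [cubeNumerator_mul]
  exact integrable_finsetSum _ fun k _ => (integrable_prod_filter_mul_prod_rpow _ 0 hs).sub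
    (integrable_prod_filter_mul_prod_rpow _ k hs)

theorem integral_cubeNumerator_mul_prod_rpow (j : ℕ) {s : ℝ} (hs : 0 < s) :
    ∫ x, cubeNumerator j x * ∏ i, x i ^ s ∂cubeMeasure (j + 2) =
      (j + 1) / (s + 1) ^ (j + 2) - 1 / (s + 1) ^ (j + 1) + 1 / (s + 1 + 1) ^ (j + 1) := by
  simp only [cubeNumerator_mul]
  have hi : ∀ k ∈ Finset.Icc 1 (j + 1), Integrable (fun x : Fin (j + 2) → ℝ =>
      (∏ i with Fin.val i < 0, x i) * ∏ i, x i ^ s -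
        (∏ i with Fin.val i < k, x i) * ∏ i, x i ^ s) (cubeMeasure (j + 2)) := fun k _ =>
    (integrable_prod_filter_mul_prod_rpow _ 0 hs).sub (integrable_prod_filter_mul_prod_rpow _ k hs)
  rw [integral_finsetSum _ hi, ← sum_geometric_mixed j (by positivity)]
  refine Finset.sum_congr rfl fun k hk => ?_
  have := (Finset.mem_Icc.1 hk).2
  rw [integral_sub (integrable_prod_filter_mul_prod_rpow _ 0 hs)
    (integrable_prod_filter_mul_prod_rpow _ k hs), integral_prod_filter_mul_prod_rpow (by omega) hs,
    integral_prod_filter_mul_prod_rpow (by omega) hs, pow_zero, one_mul, Nat.sub_zero]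
  congr 4
  ring

theorem measurable_cubeNumerator (j : ℕ) : Measurable (cubeNumerator j) := by
  unfold cubeNumerator
  fun_prop

/-! ### The Gamma integral and the exchange of integrals -/

theorem integral_Ioi_pow_mul_exp_neg_mul (j : ℕ) {r : ℝ} (hr : 0 < r) :
    ∫ t in Set.Ioi (0 : ℝ), t ^ j * Real.exp (-(r * t)) = j.factorial / r ^ (j + 1) := by
  have h := Real.integral_rpow_mul_exp_neg_mul_Ioi (a := (j : ℝ) + 1) (by positivity) hr
  simp only [add_sub_cancel_right, Real.rpow_natCast] at h
  rw [h, Real.Gamma_nat_eq_factorial, ← Nat.cast_succ, Real.rpow_natCast, one_div_pow]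
  field_simp

theorem prod_rpow_add_natCast {m : ℕ} {x : Fin m → ℝ} (hx : ∀ i, 0 < x i) (t : ℝ) (n : ℕ) :
    ∏ i, x i ^ (t + n) = (∏ i, x i) ^ n * Real.exp (-(-Real.log (∏ i, x i) * t)) := by
  have hP : 0 < ∏ i, x i := Finset.prod_pos fun i _ => hx i
  rw [Real.finsetProd_rpow _ _ fun i _ => (hx i).le, Real.rpow_add hP, Real.rpow_natCast,
    Real.rpow_def_of_pos hP, neg_mul, neg_neg, mul_comm]

theorem prod_mem_Ioo {j : ℕ} {x : Fin (j + 2) → ℝ} (hx : ∀ i, x i ∈ Set.Ioo (0 : ℝ) 1) :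
    ∏ i, x i ∈ Set.Ioo (0 : ℝ) 1 := by
  refine ⟨Finset.prod_pos fun i _ => (hx i).1, ?_⟩
  rw [Fin.prod_univ_succ]
  exact mul_lt_one_of_nonneg_of_lt_one_left (hx 0).1.le (hx 0).2
    (Finset.prod_le_one (fun i _ => (hx _).1.le) fun i _ => (hx _).2.le)

theorem integral_Ioi_pow_mul_cubeNumerator (j n : ℕ) {x : Fin (j + 2) → ℝ}
    (hx : ∀ i, x i ∈ Set.Ioo (0 : ℝ) 1) :
    ∫ t in Set.Ioi (0 : ℝ), t ^ j * (cubeNumerator j x * ∏ i, x i ^ (t + n)) =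
      j.factorial * (cubeNumerator j x * (∏ i, x i) ^ n /
        (-Real.log (∏ i, x i)) ^ (j + 1)) := by
  have hP := prod_mem_Ioo hx
  have hlog : 0 < -Real.log (∏ i, x i) := neg_pos.2 (Real.log_neg hP.1 hP.2)
  have e : ∀ t : ℝ, t ^ j * (cubeNumerator j x * ∏ i, x i ^ (t + n)) =
      cubeNumerator j x * (∏ i, x i) ^ n *
        (t ^ j * Real.exp (-(-Real.log (∏ i, x i) * t))) := by
    intro t
    rw [prod_rpow_add_natCast fun i => (hx i).1]
    ring
  simp only [e]
  rw [integral_const_mul, integral_Ioi_pow_mul_exp_neg_mul j hlog]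
  ring

theorem integral_cube_pow_mul_cubeNumerator (j n : ℕ) {t : ℝ} (ht : 0 < t) :
    ∫ x, t ^ j * (cubeNumerator j x * ∏ i, x i ^ (t + n)) ∂cubeMeasure (j + 2) =
      t ^ j * ((j + 1) / (t + (n + 1)) ^ (j + 2) - 1 / (t + (n + 1)) ^ (j + 1) +
        1 / (t + (n + 1) + 1) ^ (j + 1)) := by
  rw [integral_const_mul, integral_cubeNumerator_mul_prod_rpow j (by positivity), add_assoc t]

theorem pow_mul_cubeNumerator_nonneg (j n : ℕ) {t : ℝ} (ht : 0 < t) {x : Fin (j + 2) → ℝ}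
    (hx : ∀ i, x i ∈ Set.Ioo (0 : ℝ) 1) :
    0 ≤ t ^ j * (cubeNumerator j x * ∏ i, x i ^ (t + n)) :=
  mul_nonneg (by positivity) <| mul_nonneg (cubeNumerator_nonneg hx) <|
    Finset.prod_nonneg fun i _ => Real.rpow_nonneg (hx i).1.le _

theorem integrableOn_and_integral_Ioi_cube (j n : ℕ) :
    IntegrableOn (fun t : ℝ => ∫ x, t ^ j * (cubeNumerator j x * ∏ i, x i ^ (t + n))
      ∂cubeMeasure (j + 2)) (Set.Ioi 0) ∧
    ∫ t in Set.Ioi (0 : ℝ), ∫ x, t ^ j * (cubeNumerator j x * ∏ i, x i ^ (t + n))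
      ∂cubeMeasure (j + 2) = 1 / ((n : ℝ) + 1) - (Real.log (n + 2) - Real.log (n + 1)) := by
  have h := integrableOn_and_integral_Ioi_rational j (N := (n : ℝ) + 1) (by positivity) ?_
  · refine ⟨h.1.congr_fun (fun t ht => (integral_cube_pow_mul_cubeNumerator j n ht).symm)
      measurableSet_Ioi, ?_⟩
    rw [setIntegral_congr_fun measurableSet_Ioi
      fun t ht => integral_cube_pow_mul_cubeNumerator j n ht, h.2, add_assoc (n : ℝ) 1 1,
      one_add_one_eq_two]
  -- The sign of the rational function is read off from its being a cube integral of a nonnegative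
  -- function.
  · intro t ht
    rw [← integral_cube_pow_mul_cubeNumerator j n ht]
    refine integral_nonneg_of_ae ?_
    filter_upwards [ae_cubeMeasure_mem_Ioo (j + 2)] with x hx
    exact pow_mul_cubeNumerator_nonneg j n ht hx

theorem integrable_prod_pow_mul_cubeNumerator (j n : ℕ) :
    Integrable (Function.uncurry fun (t : ℝ) (x : Fin (j + 2) → ℝ) =>
      t ^ j * (cubeNumerator j x * ∏ i, x i ^ (t + n)))
      ((volume.restrict (Set.Ioi 0)).prod (cubeMeasure (j + 2))) := by
  have hm : Measurable (Function.uncurry fun (t : ℝ) (x : Fin (j + 2) → ℝ) =>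
      t ^ j * (cubeNumerator j x * ∏ i, x i ^ (t + n))) := by
    have := measurable_cubeNumerator j
    unfold Function.uncurry
    fun_prop
  rw [integrable_prod_iff hm.aestronglyMeasurable]
  constructor
  · filter_upwards [ae_restrict_mem measurableSet_Ioi] with t ht
    have ht : 0 < t := ht
    exact (integrable_cubeNumerator_mul_prod_rpow j (s := t + n) (by positivity)).const_mul (t ^ j)
  · refine (integrableOn_and_integral_Ioi_cube j n).1.congr_fun (fun t ht => ?_) measurableSet_Ioi
    refine integral_congr_ae ?_
    filter_upwards [ae_cubeMeasure_mem_Ioo (j + 2)] with x hx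
    exact (Real.norm_of_nonneg (pow_mul_cubeNumerator_nonneg j n ht hx)).symm

/-! ### Termwise integration of the geometric expansion -/

/-- The `n`-th term, up to sign, of the expansion of the integrand in powers of `x₁ ⋯ x_m`. -/
noncomputable def cubeTerm (j n : ℕ) (x : Fin (j + 2) → ℝ) : ℝ :=
  cubeNumerator j x * (∏ i, x i) ^ n / (-Real.log (∏ i, x i)) ^ (j + 1)

theorem cubeTerm_nonneg (j n : ℕ) {x : Fin (j + 2) → ℝ} (hx : ∀ i, x i ∈ Set.Ioo (0 : ℝ) 1) :
    0 ≤ cubeTerm j n x :=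
  have hP := prod_mem_Ioo hx
  div_nonneg (mul_nonneg (cubeNumerator_nonneg hx) (pow_nonneg hP.1.le _)) <|
    pow_nonneg (neg_nonneg.2 (Real.log_neg hP.1 hP.2).le) _

theorem integrable_cubeTerm (j n : ℕ) : Integrable (cubeTerm j n) (cubeMeasure (j + 2)) := by
  refine ((integrable_prod_pow_mul_cubeNumerator j n).integral_prod_right.const_mul
    ((j.factorial : ℝ)⁻¹)).congr ?_
  filter_upwards [ae_cubeMeasure_mem_Ioo (j + 2)] with x hx
  simp only [Function.uncurry_apply_pair]
  rw [integral_Ioi_pow_mul_cubeNumerator j n hx, inv_mul_cancel_left₀ (by positivity), cubeTerm]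

theorem factorial_mul_integral_cubeTerm (j n : ℕ) :
    j.factorial * ∫ x, cubeTerm j n x ∂cubeMeasure (j + 2) =
      1 / ((n : ℝ) + 1) - (Real.log (n + 2) - Real.log (n + 1)) := by
  rw [← (integrableOn_and_integral_Ioi_cube j n).2,
    integral_integral_swap (integrable_prod_pow_mul_cubeNumerator j n), ← integral_const_mul]
  refine integral_congr_ae ?_
  filter_upwards [ae_cubeMeasure_mem_Ioo (j + 2)] with x hx
  rw [integral_Ioi_pow_mul_cubeNumerator j n hx, cubeTerm]

/-- The integrand, in the dimension `j + 2`. -/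
noncomputable def cubeIntegrand (j : ℕ) (x : Fin (j + 2) → ℝ) : ℝ :=
  cubeNumerator j x / ((1 + ∏ i, x i) * (-Real.log (∏ i, x i)) ^ (j + 1))

theorem hasSum_cubeTerm (j : ℕ) {x : Fin (j + 2) → ℝ} (hx : ∀ i, x i ∈ Set.Ioo (0 : ℝ) 1) :
    HasSum (fun n => (-1) ^ n * cubeTerm j n x) (cubeIntegrand j x) := by
  have hP := prod_mem_Ioo hx
  have h := (hasSum_geometric_of_abs_lt_one (r := -∏ i, x i)
    (by rw [abs_neg, abs_of_pos hP.1]; exact hP.2)).mul_left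
    (cubeNumerator j x / (-Real.log (∏ i, x i)) ^ (j + 1))
  rw [sub_neg_eq_add, ← div_eq_mul_inv, div_div, mul_comm (_ ^ (j + 1))] at h
  refine h.congr_fun fun n => ?_
  rw [cubeTerm, neg_pow]
  ring

theorem integrable_cubeIntegrand (j : ℕ) : Integrable (cubeIntegrand j) (cubeMeasure (j + 2)) := by
  have hm : Measurable (cubeIntegrand j) := by
    have := measurable_cubeNumerator j
    unfold cubeIntegrand
    fun_prop
  -- Since 1 + P ≥ 1, the term `n = 0` dominates the integrand.
  refine (integrable_cubeTerm j 0).mono' hm.aestronglyMeasurable ?_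
  filter_upwards [ae_cubeMeasure_mem_Ioo (j + 2)] with x hx
  have hP := prod_mem_Ioo hx
  have e : cubeIntegrand j x = cubeTerm j 0 x / (1 + ∏ i, x i) := by
    rw [cubeIntegrand, cubeTerm, pow_zero, mul_one, div_div, mul_comm (1 + _)]
  rw [e, Real.norm_of_nonneg (div_nonneg (cubeTerm_nonneg j 0 hx) (by linarith [hP.1]))]
  exact div_le_self (cubeTerm_nonneg j 0 hx) (by linarith [hP.1])

theorem factorial_mul_integral_cubeIntegrand (j : ℕ) :
    j.factorial * ∫ x, cubeIntegrand j x ∂cubeMeasure (j + 2) = Real.log (4 / Real.pi) := by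
  have hI : ∀ n, ∫ x, cubeTerm j n x ∂cubeMeasure (j + 2) = (j.factorial : ℝ)⁻¹ *
      (1 / ((n : ℝ) + 1) - (Real.log (n + 2) - Real.log (n + 1))) := fun n => by
    rw [← factorial_mul_integral_cubeTerm, inv_mul_cancel_left₀ (by positivity)]
  have h := hasSum_integral_of_summable_integral_norm
    (F := fun n x => (-1 : ℝ) ^ n * cubeTerm j n x) (μ := cubeMeasure (j + 2))
    (fun n => (integrable_cubeTerm j n).const_mul _) ?_
  · have e : ∫ x, ∑' n, (-1 : ℝ) ^ n * cubeTerm j n x ∂cubeMeasure (j + 2) =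
        ∫ x, cubeIntegrand j x ∂cubeMeasure (j + 2) := by
      refine integral_congr_ae ?_
      filter_upwards [ae_cubeMeasure_mem_Ioo (j + 2)] with x hx
      exact (hasSum_cubeTerm j hx).tsum_eq
    rw [e] at h
    refine (h.mul_left (j.factorial : ℝ)).unique
      (hasSum_alternating_log_four_div_pi.congr_fun fun n => ?_)
    rw [integral_const_mul, mul_left_comm, factorial_mul_integral_cubeTerm]
  -- The L¹ norms of the terms are their integrals without sign, whose sum converges; this justifies
  -- integrating termwise.
  · refine (summable_one_div_sub_log.mul_left (j.factorial : ℝ)⁻¹).congr fun n => ?_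
    rw [← hI n]
    refine integral_congr_ae ?_
    filter_upwards [ae_cubeMeasure_mem_Ioo (j + 2)] with x hx
    rw [norm_mul, norm_pow, norm_neg, norm_one, one_pow, one_mul,
      Real.norm_of_nonneg (cubeTerm_nonneg j n hx)]

theorem cubeIntegrand_eq (j : ℕ) (x : Fin (j + 2) → ℝ) :
    cubeIntegrand j x = (((j + 2 : ℕ) : ℝ) - 1 -
      ∑ k ∈ Finset.Icc 1 (j + 2 - 1), ∏ i with Fin.val i < k, x i) /
        ((1 + ∏ i, x i) * (-Real.log (∏ i, x i)) ^ (j + 2 - 1)) := by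
  rw [cubeIntegrand, cubeNumerator, Finset.sum_sub_distrib, Finset.sum_const, Nat.card_Icc]
  congr 2
  push_cast
  simp
  ring

/-- For every integer `m > 1` the integrand below is Lebesgue integrable on the cube `[0,1]^m`, and
`log (4 / π)` is `(m - 2)!` times its integral. The coordinates `x₁, …, x_m` are indexed by `Fin m`
(starting from `0`), so `x₁ ⋯ x_k` is the product of the `x i` with `i < k`. -/
theorem mainTheorem5 (m : ℕ) (hm : 1 < m) :
    MeasureTheory.IntegrableOn
      (fun x : Fin m → ℝ =>
        ((m : ℝ) - 1 - ∑ k ∈ Finset.Icc 1 (m - 1), ∏ i with Fin.val i < k, x i) /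
          ((1 + ∏ i, x i) * (-Real.log (∏ i, x i)) ^ (m - 1)))
      (Set.Icc 0 1) MeasureTheory.volume ∧
    Real.log (4 / Real.pi) =
      (Nat.factorial (m - 2) : ℝ) *
        ∫ x in (Set.Icc 0 1 : Set (Fin m → ℝ)),
          ((m : ℝ) - 1 - ∑ k ∈ Finset.Icc 1 (m - 1), ∏ i with Fin.val i < k, x i) /
            ((1 + ∏ i, x i) * (-Real.log (∏ i, x i)) ^ (m - 1)) := by
  obtain ⟨j, rfl⟩ : ∃ j, m = j + 2 := ⟨m - 2, by omega⟩
  simp only [← cubeIntegrand_eq]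
  rw [IntegrableOn, ← cubeMeasure_eq_restrict_Icc, Nat.add_sub_cancel]
  exact ⟨integrable_cubeIntegrand j, (factorial_mul_integral_cubeIntegrand j).symm⟩
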